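/- **Theorem (diameter bound).** Let $G=(V,w,m)$ be a measured and weighted graph: $V$ is a countable set, $w\colon V\times V\to[0,\infty)$ is symmetric and vanishes on the diagonal, $m\colon V\to(0,\infty)$, for every $x$ the set $\{y : w(x,y)>0\}$ is finite, and $G$ is connected (any two vertices are joined by a finite path along pairs with $w>0$). Put $q(x,y)=w(x,y)/m(x)$, $\operatorname{Deg}(x)=\sum_y q(x,y)$, and assume $\operatorname{Deg}_{\max}:=\sup_x\operatorname{Deg}(x)<\infty$. For $f,g\colon V\to\mathbb R$ let $$\Delta f(x)=\sum_y q(x,y)(f(y)-f(x)),\qquad \Gamma(f,g)=\tfrac12\big(\Delta(fg)-f\Delta g-g\Delta f\big),\qquad \Gamma_2(f,g)=\tfrac12\big(\Delta\Gamma(f,g)-\Gamma(f,\Delta g)-\Gamma(g,\Delta f)\big).$$ Let $P_t=e^{t\Delta}$, $t\ge 0$, be the heat semigroup on $\ell^\infty(V)$ (here $\Delta$ is a bounded operator because $\operatorname{Deg}_{\max}<\infty$), and for $T>0$ and $W\colon V\to[0,\infty)$ let $$k_T(W)=\sup_{j\in\mathbb N}\int_0^T\|P_t(j\wedge W)\|_\infty\,\mathrm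 dt\in[0,\infty].$$ Let $T,K>0$, $n\in(0,\infty]$ and $\rho\colon V\to\mathbb R$. Suppose that $G$ satisfies $CD(\rho,n)$, i.e. for all bounded $f\colon V\to\mathbb R$ and all $x\in V$ $$\Gamma_2(f,f)(x)\ \ge\ \rho(x)\,\Gamma(f,f)(x)+\tfrac1n(\Delta f(x))^2\qquad(\text{with } \tfrac1\infty=0),$$ and that, with $a_-:=-\min\{0,a\}$, $$k_T\big((\rho-K)_-\big)\ \le\ \tfrac14\big(1-e^{-KT/2}\big).$$ Then the diameter $\operatorname{diam}(G)=\sup_{x,y\in V}d(x,y)$ with respect to the combinatorial distance $d$ (the least number of steps of a path from $x$ to $y$ along pairs with $w>0$) is finite, and $$\operatorname{diam}(G)\ \le\ \frac{4\operatorname{Deg}_{\max}e^{KT/2}}{K}.$$ -/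

import Mathlib

open scoped ENNReal NNReal

/-- A measured and weighted graph on the vertex set `V`: symmetric nonnegative edge weights vanishing
on the diagonal, a positive vertex measure; locally finite and connected. -/
structure MWGraph (V : Type*) where
  /-- the edge weights -/
  w : V → V → ℝ
  /-- the vertex measure -/
  m : V → ℝ
  w_nonneg : ∀ x y, 0 ≤ w x y
  w_symm : ∀ x y, w x y = w y x
  w_diag : ∀ x, w x x = 0
  m_pos : ∀ x, 0 < m x
  locallyFinite : ∀ x, {y | 0 < w x y}.Finite
  connected : ∀ x y, Relation.ReflTransGen (fun a b => 0 < w a b) x y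

namespace MWGraph

variable {V : Type*}

/-- The underlying combinatorial graph: `x ∼ y` iff `w x y > 0`. Its distance and diameter are the
combinatorial distance and diameter of the weighted graph. -/
def toSimpleGraph (G : MWGraph V) : SimpleGraph V where
  Adj x y := 0 < G.w x y
  symm := ⟨fun x y h => by rw [G.w_symm y x]; exact h⟩
  loopless := ⟨fun x h => by rw [G.w_diag x] at h; exact lt_irrefl _ h⟩

/-- `q(x,y) = w(x,y) / m(x)`. -/
noncomputable def q (G : MWGraph V) (x y : V) : ℝ := G.w x y / G.m x

/-- `Deg(x) = ∑_y q(x,y)`; the sum is finite by local finiteness. -/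
noncomputable def deg (G : MWGraph V) (x : V) : ℝ := ∑ᶠ y, G.q x y

/-- `Deg_max < ∞`. -/
def BoundedDegree (G : MWGraph V) : Prop := BddAbove (Set.range G.deg)

/-- `Deg_max = sup_x Deg(x)`, used only when the degrees are bounded. -/
noncomputable def degMax (G : MWGraph V) : ℝ := ⨆ x, G.deg x

/-- The Laplacian `Δ f(x) = ∑_y q(x,y) (f(y) - f(x))`; the sum is finite by local finiteness. -/
noncomputable def laplacian (G : MWGraph V) (f : V → ℝ) (x : V) : ℝ :=
  ∑ᶠ y, G.q x y * (f y - f x)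

/-- The carré du champ `Γ(f,g) = ½ (Δ(fg) - f Δg - g Δf)`. -/
noncomputable def Gam (G : MWGraph V) (f g : V → ℝ) (x : V) : ℝ :=
  1 / 2 * (G.laplacian (fun z => f z * g z) x - f x * G.laplacian g x - g x * G.laplacian f x)

/-- `Γ₂(f,g) = ½ (Δ Γ(f,g) - Γ(f,Δg) - Γ(g,Δf))`. -/
noncomputable def Gam2 (G : MWGraph V) (f g : V → ℝ) (x : V) : ℝ :=
  1 / 2 * (G.laplacian (G.Gam f g) x - G.Gam f (G.laplacian g) x - G.Gam g (G.laplacian f) x)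

/-- The variable curvature dimension condition `CD(ρ,n)`, for `n ∈ (0,∞]`: for all bounded `f`,
`Γ₂(f) ≥ ρ Γ(f) + (1/n) (Δ f)²` pointwise, where `1/∞ = 0`. -/
def CD (G : MWGraph V) (ρ : V → ℝ) (n : ℝ≥0∞) : Prop :=
  ∀ f : V → ℝ, (∃ C : ℝ, ∀ x, |f x| ≤ C) → ∀ x,
    ρ x * G.Gam f f x + (n⁻¹).toReal * (G.laplacian f x) ^ 2 ≤ G.Gam2 f f x

theorem q_nonneg (G : MWGraph V) (x y : V) : 0 ≤ G.q x y :=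
  div_nonneg (G.w_nonneg x y) (G.m_pos x).le

theorem support_q_mul (G : MWGraph V) (x : V) (g : V → ℝ) :
    Function.support (fun y => G.q x y * g y) ⊆ ((G.locallyFinite x).toFinset : Set V) := by
  intro y hy
  have h : G.w x y ≠ 0 := by
    intro h0
    exact hy (by simp [q, h0])
  simpa using lt_of_le_of_ne (G.w_nonneg x y) h.symm

theorem finsum_q_mul (G : MWGraph V) (x : V) (g : V → ℝ) :
    ∑ᶠ y, G.q x y * g y = ∑ y ∈ (G.locallyFinite x).toFinset, G.q x y * g y :=
  finsum_eq_sum_of_support_subset _ (G.support_q_mul x g)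

theorem deg_eq_sum (G : MWGraph V) (x : V) :
    G.deg x = ∑ y ∈ (G.locallyFinite x).toFinset, G.q x y := by
  simpa [deg] using G.finsum_q_mul x (fun _ => 1)

theorem laplacian_eq_sum (G : MWGraph V) (f : V → ℝ) (x : V) :
    G.laplacian f x = ∑ y ∈ (G.locallyFinite x).toFinset, G.q x y * (f y - f x) :=
  G.finsum_q_mul x (fun y => f y - f x)

theorem deg_nonneg (G : MWGraph V) (x : V) : 0 ≤ G.deg x := by
  rw [deg_eq_sum]
  exact Finset.sum_nonneg fun y _ => G.q_nonneg x y

theorem degMax_nonneg (G : MWGraph V) : 0 ≤ G.degMax := Real.iSup_nonneg G.deg_nonneg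

theorem abs_laplacian_le (G : MWGraph V) (hG : G.BoundedDegree) (f : V → ℝ) (C : ℝ)
    (hC : ∀ x, |f x| ≤ C) (x : V) : |G.laplacian f x| ≤ 2 * G.degMax * C := by
  have hC0 : 0 ≤ C := (abs_nonneg _).trans (hC x)
  rw [laplacian_eq_sum]
  calc |∑ y ∈ (G.locallyFinite x).toFinset, G.q x y * (f y - f x)|
      ≤ ∑ y ∈ (G.locallyFinite x).toFinset, |G.q x y * (f y - f x)| :=
        Finset.abs_sum_le_sum_abs _ _
    _ ≤ ∑ y ∈ (G.locallyFinite x).toFinset, G.q x y * (2 * C) := by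
        refine Finset.sum_le_sum fun y _ => ?_
        rw [abs_mul, abs_of_nonneg (G.q_nonneg x y)]
        refine mul_le_mul_of_nonneg_left ?_ (G.q_nonneg x y)
        have := abs_sub (f y) (f x)
        linarith [hC x, hC y]
    _ = G.deg x * (2 * C) := by rw [deg_eq_sum, Finset.sum_mul]
    _ ≤ G.degMax * (2 * C) :=
        mul_le_mul_of_nonneg_right (le_ciSup hG x) (by linarith)
    _ = 2 * G.degMax * C := by ring

/-- A bounded function on `V` as an element of `ℓ^∞(V)`. -/
def toLinfty (f : V → ℝ) (C : ℝ) (hC : ∀ x, |f x| ≤ C) : lp (fun _ : V => ℝ) ∞ :=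
  ⟨f, memℓp_infty ⟨C, by rintro _ ⟨x, rfl⟩; exact hC x⟩⟩

/-- The Laplacian of a graph of bounded degree, as a bounded operator on `ℓ^∞(V)`. -/
noncomputable def laplacianCLM (G : MWGraph V) (hG : G.BoundedDegree) :
    lp (fun _ : V => ℝ) ∞ →L[ℝ] lp (fun _ : V => ℝ) ∞ :=
  LinearMap.mkContinuous
    { toFun := fun f => toLinfty (G.laplacian f) (2 * G.degMax * ‖f‖)
        (G.abs_laplacian_le hG f ‖f‖ fun x => lp.norm_apply_le_norm (by simp) f x)
      map_add' := fun f g => by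
        ext x
        change G.laplacian (f + g : lp (fun _ : V => ℝ) ∞) x = G.laplacian f x + G.laplacian g x
        simp only [laplacian_eq_sum, ← Finset.sum_add_distrib, lp.coeFn_add, Pi.add_apply]
        exact Finset.sum_congr rfl fun y _ => by ring
      map_smul' := fun c f => by
        ext x
        change G.laplacian (c • f : lp (fun _ : V => ℝ) ∞) x = c * G.laplacian f x
        simp only [laplacian_eq_sum, Finset.mul_sum, lp.coeFn_smul, Pi.smul_apply, smul_eq_mul]
        exact Finset.sum_congr rfl fun y _ => by ring }
    (2 * G.degMax)
    fun f => lp.norm_le_of_forall_le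
      (mul_nonneg (mul_nonneg zero_le_two G.degMax_nonneg) (norm_nonneg f))
      (G.abs_laplacian_le hG f ‖f‖ fun x => lp.norm_apply_le_norm (by simp) f x)

/-- The heat semigroup `P_t = e^{tΔ}` on `ℓ^∞(V)`. For bounded degree `Δ` is a bounded operator,
so the semigroup it generates is given by the exponential series. -/
noncomputable def heat (G : MWGraph V) (hG : G.BoundedDegree) (t : ℝ) :
    lp (fun _ : V => ℝ) ∞ →L[ℝ] lp (fun _ : V => ℝ) ∞ :=
  NormedSpace.exp (t • G.laplacianCLM hG)

/-- The truncation `n ∧ W` of a nonnegative function, as an element of `ℓ^∞(V)`. -/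
noncomputable def trunc (n : ℕ) (W : V → ℝ≥0) : lp (fun _ : V => ℝ) ∞ :=
  toLinfty (fun x => min (n : ℝ) (W x)) n fun x => by
    rw [abs_of_nonneg (le_min n.cast_nonneg (W x).coe_nonneg)]
    exact min_le_left _ _

/-- `k_T(W) = sup_n ∫_0^T ‖P_t (n ∧ W)‖_∞ dt ∈ [0,∞]`. -/
noncomputable def katoConst (G : MWGraph V) (hG : G.BoundedDegree) (T : ℝ) (W : V → ℝ≥0) : ℝ≥0∞ :=
  ⨆ n : ℕ, ∫⁻ t in Set.Ioc 0 T, ‖G.heat hG t (trunc n W)‖ₑ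

end MWGraph

/-! ### Carré du champ and curvature in bounded degree. -/

namespace MWGraph

variable {V : Type*}

/-! The heat flow flattens the truncated distance function: the total movement at each vertex is
bounded, while the differences between vertices tend to zero. Let `v` be `(ρ - K)₋` cut off at a
level `j ≥ Deg_max + K`. Since bounded degree forces `Γ₂ ≥ -Deg_max Γ`, still `Γ₂ ≥ (K - v) Γ`
(`CD.truncated`). Duhamel's formula along `e^{2Ks} P_{t-s} Γ(P_s f)` bounds the growth of `Γ(P_t f)`
by `∫ ‖P_s v‖`. Kato smallness allows this to be absorbed on `[0,T]`, and the semigroup property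
then gives `‖Γ(P_t f)‖ ≤ e^{KT} e^{-Kt} ‖Γ(f)‖` for all `t ≥ 0` (`norm_gammaLp_heat_le`). By
Cauchy–Schwarz, `|Δ P_t f| ≤ Deg_max e^{KT/2} e^{-Kt/2}` for 1-Lipschitz `f`; integrating in time,
`|P_t f - f| ≤ 2 Deg_max e^{KT/2} / K`. Since `Γ(P_t f) → 0` and the graph is connected, `P_t f(y) -
P_t f(x) → 0`. Paying the movement at both `x` and `y` bounds `d(x,y)` (`dist_le_of_gammaLp_decay`).
-/

theorem Gam_eq_sum (G : MWGraph V) (f g : V → ℝ) (x : V) :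
    G.Gam f g x = 1 / 2 * ∑ y ∈ (G.locallyFinite x).toFinset,
      G.q x y * ((f y - f x) * (g y - g x)) := by
  simp only [Gam, laplacian_eq_sum, Finset.mul_sum, ← Finset.sum_sub_distrib]
  exact Finset.sum_congr rfl fun y _ => by ring

theorem Gam_self_nonneg (G : MWGraph V) (f : V → ℝ) (x : V) : 0 ≤ G.Gam f f x := by
  rw [Gam_eq_sum]
  exact mul_nonneg (by norm_num) (Finset.sum_nonneg fun y _ =>
    mul_nonneg (G.q_nonneg x y) (mul_self_nonneg _))

theorem deg_le_degMax (G : MWGraph V) (hG : G.BoundedDegree) (x : V) : G.deg x ≤ G.degMax :=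
  le_ciSup hG x

/-- Cauchy–Schwarz for the weights `q(x,·)` of total mass `Deg(x)`. It yields both the crude
curvature bound and the passage from decay of `Γ` to decay of `Δ P_t f`. -/
theorem laplacian_sq_le (G : MWGraph V) (hG : G.BoundedDegree) (f : V → ℝ) (x : V) :
    G.laplacian f x ^ 2 ≤ 2 * G.degMax * G.Gam f f x := by
  have h : G.laplacian f x ^ 2 ≤ G.deg x * (2 * G.Gam f f x) := by
    rw [laplacian_eq_sum, deg_eq_sum, Gam_eq_sum, ← mul_assoc 2, mul_one_div_cancel two_ne_zero,
      one_mul]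
    refine Finset.sum_sq_le_sum_mul_sum_of_sq_le_mul _ (fun y _ => G.q_nonneg x y)
      (fun y _ => mul_nonneg (G.q_nonneg x y) (mul_self_nonneg _)) fun y _ => le_of_eq (by ring)
  refine h.trans ?_
  nlinarith [G.deg_le_degMax hG x, G.Gam_self_nonneg f x]

theorem q_mul_sub_sq_le (G : MWGraph V) (f : V → ℝ) {x y : V} (h : 0 < G.w x y) :
    G.q x y * (f y - f x) ^ 2 ≤ 2 * G.Gam f f x := by
  rw [Gam_eq_sum, ← mul_assoc, mul_one_div_cancel two_ne_zero, one_mul, pow_two]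
  exact Finset.single_le_sum (f := fun y => G.q x y * ((f y - f x) * (f y - f x)))
    (fun z _ => mul_nonneg (G.q_nonneg x z) (mul_self_nonneg _)) (by simpa using h)

/-- A function with increments at most one along edges has `Γ(f) ≤ Deg_max / 2`. -/
theorem Gam_self_le_of_lipschitz (G : MWGraph V) (hG : G.BoundedDegree) (f : V → ℝ)
    (hf : ∀ x y, 0 < G.w x y → |f y - f x| ≤ 1) (x : V) : G.Gam f f x ≤ G.degMax / 2 := by
  have h : ∑ y ∈ (G.locallyFinite x).toFinset, G.q x y * ((f y - f x) * (f y - f x))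
      ≤ G.deg x := by
    rw [deg_eq_sum]
    refine Finset.sum_le_sum fun y hy => mul_le_of_le_one_right (G.q_nonneg x y) ?_
    rw [← abs_mul_abs_self]
    exact mul_le_one₀ (hf x y (by simpa using hy)) (abs_nonneg _) (hf x y (by simpa using hy))
  rw [Gam_eq_sum]
  linarith [G.deg_le_degMax hG x]

/-- Graphs of bounded degree have curvature bounded below by `-Deg_max`. -/
theorem neg_degMax_mul_Gam_le_Gam2 (G : MWGraph V) (hG : G.BoundedDegree) (f : V → ℝ) (x : V) :
    -G.degMax * G.Gam f f x ≤ G.Gam2 f f x := by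
  set D := G.degMax
  set S := (G.locallyFinite x).toFinset
  have hD : 0 ≤ D := G.degMax_nonneg
  have hsum : G.Gam2 f f x = 1 / 2 * ∑ y ∈ S,
      G.q x y * (G.Gam f f y - (f y - f x) * G.laplacian f y)
      - 1 / 2 * (G.deg x * G.Gam f f x) + 1 / 2 * G.laplacian f x ^ 2 := by
    have h2 : G.laplacian f x ^ 2 = ∑ y ∈ S, G.q x y * (f y - f x) * G.laplacian f x := by
      rw [← Finset.sum_mul, ← laplacian_eq_sum, pow_two]
    rw [h2, deg_eq_sum, Finset.sum_mul, Gam2, laplacian_eq_sum, G.Gam_eq_sum f (G.laplacian f)]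
    change _ = 1 / 2 * _ - 1 / 2 * ∑ y ∈ S, _ + _
    simp only [Finset.mul_sum, ← Finset.sum_sub_distrib, ← Finset.sum_add_distrib, S]
    exact Finset.sum_congr rfl fun y _ => by ring
  have hle : -(D / 2) * (2 * G.Gam f f x) ≤ ∑ y ∈ S,
      G.q x y * (G.Gam f f y - (f y - f x) * G.laplacian f y) := by
    rw [G.Gam_eq_sum f f x, ← mul_assoc 2, mul_one_div_cancel two_ne_zero, one_mul,
      Finset.mul_sum]
    refine Finset.sum_le_sum fun y _ => ?_
    rw [mul_left_comm]
    refine mul_le_mul_of_nonneg_left ?_ (G.q_nonneg x y)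
    have hg := G.Gam_self_nonneg f y
    have ha : 0 ≤ D / 2 * ((f y - f x) * (f y - f x)) :=
      mul_nonneg (by linarith) (mul_self_nonneg _)
    have hδ := G.laplacian_sq_le hG f y
    set a := f y - f x
    -- AM–GM: `(a Δf(y))² ≤ 4 · (D a²/2) · Γ(f)(y) ≤ (D a²/2 + Γ(f)(y))²`.
    have : a * G.laplacian f y ≤ D / 2 * (a * a) + G.Gam f f y := by
      refine (abs_le_of_sq_le_sq' ?_ (by linarith)).2
      have h1 : (a * G.laplacian f y) ^ 2 ≤ a ^ 2 * (2 * D * G.Gam f f y) := by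
        rw [mul_pow]
        exact mul_le_mul_of_nonneg_left hδ (sq_nonneg a)
      nlinarith [sq_nonneg (D / 2 * (a * a) - G.Gam f f y)]
    linarith
  have hdeg := mul_le_mul_of_nonneg_right (G.deg_le_degMax hG x) (G.Gam_self_nonneg f x)
  rw [hsum]
  nlinarith [sq_nonneg (G.laplacian f x)]

/-- In bounded degree, a curvature bound `CD(ρ,n)` is also a bound by `K - min(j, (ρ - K)₋)` for
large `j`. -/
theorem CD.truncated {G : MWGraph V} (hG : G.BoundedDegree) {ρ : V → ℝ} {n : ℝ≥0∞}
    (h : G.CD ρ n) {K : ℝ} {j : ℕ} (hj : G.degMax + K ≤ j) (f : V → ℝ)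
    (hf : ∃ C : ℝ, ∀ x, |f x| ≤ C) (x : V) :
    (K - min (j : ℝ) (ρ x - K)⁻) * G.Gam f f x ≤ G.Gam2 f f x := by
  have hΓ := G.Gam_self_nonneg f x
  -- Where the cutoff is active, `K - j ≤ -Deg_max` and the crude bound suffices; elsewhere `K - (ρ
  -- - K)₋ ≤ ρ` and the dimension term is dropped.
  rcases le_total (j : ℝ) (ρ x - K)⁻ with hle | hle
  · rw [min_eq_left hle]
    refine le_trans ?_ (G.neg_degMax_mul_Gam_le_Gam2 hG f x)
    exact mul_le_mul_of_nonneg_right (by linarith) hΓ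
  · rw [min_eq_right hle]
    have h0 : 0 ≤ (n⁻¹).toReal * G.laplacian f x ^ 2 :=
      mul_nonneg ENNReal.toReal_nonneg (sq_nonneg _)
    have h1 : (K - (ρ x - K)⁻) * G.Gam f f x ≤ ρ x * G.Gam f f x :=
      mul_le_mul_of_nonneg_right (by linarith [neg_le_negPart (ρ x - K)]) hΓ
    linarith [h f hf x]

end MWGraph

/-! ### Exponentials in a Banach algebra. -/

namespace NormedSpace

variable {𝔸 : Type*} [NormedRing 𝔸] [NormedAlgebra ℝ 𝔸]

theorem exp_zero_smul (a : 𝔸) : exp ((0 : ℝ) • a) = 1 := by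
  rw [zero_smul, exp_zero]

theorem exp_add_smul [CompleteSpace 𝔸] (s t : ℝ) (a : 𝔸) : exp ((s + t) • a) = exp (s • a) * exp (t • a) := by
  let _ : NormedAlgebra ℚ 𝔸 := NormedAlgebra.restrictScalars ℚ ℝ 𝔸
  rw [add_smul]
  exact exp_add_of_commute (((Commute.refl a).smul_left s).smul_right t)

theorem exp_smul_eq_exp_shift [CompleteSpace 𝔸] (t D : ℝ) (a : 𝔸) :
    exp (t • a) = Real.exp (-(t * D)) • exp (t • (a + D • 1)) := by
  let _ : NormedAlgebra ℚ 𝔸 := NormedAlgebra.restrictScalars ℚ ℝ 𝔸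
  have h1 : t • a = algebraMap ℝ 𝔸 (-(t * D)) + t • (a + D • 1) := by
    rw [Algebra.algebraMap_eq_smul_one, smul_add, smul_smul, neg_smul]
    abel
  rw [h1, exp_add_of_commute (Algebra.commutes _ _), ← algebraMap_exp_comm, Real.exp_eq_exp_ℝ,
    ← Algebra.smul_def]

end NormedSpace

/-! ### The heat semigroup on `ℓ^∞`. -/

namespace MWGraph

variable {V : Type*}

theorem laplacianCLM_apply (G : MWGraph V) (hG : G.BoundedDegree) (f : lp (fun _ : V => ℝ) ∞)
    (x : V) : G.laplacianCLM hG f x = G.laplacian f x := rfl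

theorem abs_apply_le_norm (f : lp (fun _ : V => ℝ) ∞) (x : V) : |f x| ≤ ‖f‖ :=
  lp.norm_apply_le_norm (by simp) f x

theorem hasDerivAt_heat (G : MWGraph V) (hG : G.BoundedDegree) (t : ℝ) :
    HasDerivAt (G.heat hG) (G.heat hG t * G.laplacianCLM hG) t :=
  hasDerivAt_exp_smul_const (G.laplacianCLM hG) t

theorem hasDerivAt_heat' (G : MWGraph V) (hG : G.BoundedDegree) (t : ℝ) :
    HasDerivAt (G.heat hG) (G.laplacianCLM hG * G.heat hG t) t :=
  hasDerivAt_exp_smul_const' (G.laplacianCLM hG) t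

theorem continuous_heat (G : MWGraph V) (hG : G.BoundedDegree) : Continuous (G.heat hG) :=
  continuous_iff_continuousAt.2 fun t => (G.hasDerivAt_heat hG t).continuousAt

theorem heat_zero (G : MWGraph V) (hG : G.BoundedDegree) : G.heat hG 0 = 1 :=
  NormedSpace.exp_zero_smul (G.laplacianCLM hG)

theorem heat_add (G : MWGraph V) (hG : G.BoundedDegree) (s t : ℝ) :
    G.heat hG (s + t) = G.heat hG s * G.heat hG t := 
  NormedSpace.exp_add_smul s t (G.laplacianCLM hG)

/-- The exponential of a positivity preserving operator on `ℓ^∞` is positivity preserving. -/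
theorem exp_apply_nonneg (A : lp (fun _ : V => ℝ) ∞ →L[ℝ] lp (fun _ : V => ℝ) ∞)
    (hA : ∀ f : lp (fun _ : V => ℝ) ∞, (∀ x, 0 ≤ f x) → ∀ x, 0 ≤ A f x)
    (f : lp (fun _ : V => ℝ) ∞) (hf : ∀ x, 0 ≤ f x) (x : V) : 0 ≤ NormedSpace.exp A f x := by
  have hpow : ∀ k : ℕ, ∀ x, 0 ≤ (A ^ k) f x := by
    intro k
    induction k with
    | zero => simpa using hf
    | succ k ih =>
      rw [pow_succ']
      exact hA _ ih
  have hs := NormedSpace.exp_series_hasSum_exp' (𝕂 := ℝ) A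
  -- Evaluation at `f` and then at `x` is continuous and linear, so the series may be summed
  -- pointwise.
  have hs' := hs.mapL ((lp.evalCLM ℝ (fun _ : V => ℝ) ∞ x).comp
    (ContinuousLinearMap.apply ℝ (lp (fun _ : V => ℝ) ∞) f))
  refine hs'.nonneg fun k => ?_
  exact mul_nonneg (by positivity) (hpow k x)

/-- `Δ + Deg_max` preserves positivity: its off-diagonal coefficients are `q ≥ 0` and its diagonal
is `Deg_max - Deg ≥ 0`. The shift only costs the positive scalar `e^{-t Deg_max}`. -/
theorem heat_nonneg (G : MWGraph V) (hG : G.BoundedDegree) {t : ℝ} (ht : 0 ≤ t)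
    (f : lp (fun _ : V => ℝ) ∞) (hf : ∀ x, 0 ≤ f x) (x : V) : 0 ≤ G.heat hG t f x := by
  set D := G.degMax
  set B : lp (fun _ : V => ℝ) ∞ →L[ℝ] lp (fun _ : V => ℝ) ∞ := t • (G.laplacianCLM hG + D • 1)
  have hpos : ∀ f : lp (fun _ : V => ℝ) ∞, (∀ x, 0 ≤ f x) → ∀ x, 0 ≤ B f x := by
    intro f hf x
    refine mul_nonneg ht ?_
    change 0 ≤ G.laplacian f x + D * f x
    have h1 : G.laplacian f x = ∑ y ∈ (G.locallyFinite x).toFinset, G.q x y * f y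
        - G.deg x * f x := by
      rw [laplacian_eq_sum, deg_eq_sum, Finset.sum_mul, ← Finset.sum_sub_distrib]
      exact Finset.sum_congr rfl fun y _ => by ring
    have h2 : 0 ≤ ∑ y ∈ (G.locallyFinite x).toFinset, G.q x y * f y :=
      Finset.sum_nonneg fun y _ => mul_nonneg (G.q_nonneg x y) (hf y)
    have h3 := mul_le_mul_of_nonneg_right (G.deg_le_degMax hG x) (hf x)
    linarith
  have hsplit : G.heat hG t = Real.exp (-(t * D)) • NormedSpace.exp B := 
    NormedSpace.exp_smul_eq_exp_shift t D (G.laplacianCLM hG)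
  rw [hsplit]
  exact mul_nonneg (Real.exp_pos _).le (exp_apply_nonneg B hpos f hf x)

theorem heat_mono (G : MWGraph V) (hG : G.BoundedDegree) {t : ℝ} (ht : 0 ≤ t)
    {f g : lp (fun _ : V => ℝ) ∞} (hfg : ∀ x, f x ≤ g x) (x : V) :
    G.heat hG t f x ≤ G.heat hG t g x := by
  have h := G.heat_nonneg hG ht (g - f) (fun y => sub_nonneg.2 (hfg y)) x
  rw [map_sub] at h
  exact sub_nonneg.1 h

/-- Since `Δ1 = 0`, the derivative `P_s Δ1` vanishes. With monotonicity this makes `P_t` a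
contraction in the sup norm. -/
theorem heat_one (G : MWGraph V) (hG : G.BoundedDegree) (t : ℝ) : G.heat hG t 1 = 1 := by
  have hder : ∀ s, HasDerivAt (fun s => G.heat hG s 1) 0 s := by
    intro s
    have h := (G.hasDerivAt_heat hG s).clm_apply (hasDerivAt_const s (1 : lp (fun _ : V => ℝ) ∞))
    have h1 : G.laplacianCLM hG 1 = 0 := by
      ext x
      rw [laplacianCLM_apply, laplacian_eq_sum]
      simp
    simpa [h1] using h
  have h := is_const_of_deriv_eq_zero (fun s => (hder s).differentiableAt)
    (fun s => (hder s).deriv) t 0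
  simpa [heat_zero] using h

theorem heat_apply_le_norm (G : MWGraph V) (hG : G.BoundedDegree) {t : ℝ} (ht : 0 ≤ t)
    (f : lp (fun _ : V => ℝ) ∞) (x : V) : G.heat hG t f x ≤ ‖f‖ := by
  have h := G.heat_mono hG ht (f := f) (g := ‖f‖ • 1)
    (fun y => by simpa using (le_abs_self _).trans (abs_apply_le_norm f y)) x
  rw [map_smul, heat_one] at h
  simpa using h

/-- The function `Γ(f)` as an element of `ℓ^∞(V)`. -/
noncomputable def gammaLp (G : MWGraph V) (hG : G.BoundedDegree) (f : lp (fun _ : V => ℝ) ∞) :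
    lp (fun _ : V => ℝ) ∞ :=
  (1 / 2 : ℝ) • G.laplacianCLM hG (f * f) - f * G.laplacianCLM hG f

theorem gammaLp_apply (G : MWGraph V) (hG : G.BoundedDegree) (f : lp (fun _ : V => ℝ) ∞)
    (x : V) : G.gammaLp hG f x = G.Gam f f x := by
  change 1 / 2 * G.laplacian (fun z => f z * f z) x - f x * G.laplacian f x = _
  rw [Gam]
  ring

theorem gammaLp_nonneg (G : MWGraph V) (hG : G.BoundedDegree) (f : lp (fun _ : V => ℝ) ∞)
    (x : V) : 0 ≤ G.gammaLp hG f x := by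
  rw [gammaLp_apply]
  exact G.Gam_self_nonneg f x

/-- The derivative of `Γ(P_t f)` is `2 Γ(P_t f, Δ P_t f)`. -/
theorem exists_hasDerivAt_gammaLp_heat (G : MWGraph V) (hG : G.BoundedDegree)
    (f : lp (fun _ : V => ℝ) ∞) (t : ℝ) :
    ∃ u' : lp (fun _ : V => ℝ) ∞, HasDerivAt (fun s => G.gammaLp hG (G.heat hG s f)) u' t ∧
      ∀ x, u' x = G.laplacianCLM hG (G.gammaLp hG (G.heat hG t f)) x
        - 2 * G.Gam2 (G.heat hG t f) (G.heat hG t f) x := by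
  set L := G.laplacianCLM hG
  have hp : HasDerivAt (fun s => G.heat hG s f) (L (G.heat hG t f)) t := by
    simpa using (G.hasDerivAt_heat' hG t).clm_apply (hasDerivAt_const t f)
  have hLp := L.hasFDerivAt.comp_hasDerivAt t hp
  have hLpp := L.hasFDerivAt.comp_hasDerivAt t (hp.mul hp)
  -- Product rule in `½ Δ(p²) - p Δp`. The result `2 Γ(p,Δp)` equals `ΔΓ(p) - 2 Γ₂(p)` by the
  -- definition of `Γ₂`.
  refine ⟨_, (hLpp.const_smul (1 / 2 : ℝ)).sub (hp.mul hLp), fun x => ?_⟩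
  have hfun : G.laplacian (G.gammaLp hG (G.heat hG t f)) x
      = G.laplacian (G.Gam (G.heat hG t f) (G.heat hG t f)) x := by
    congr 1
    ext y
    exact G.gammaLp_apply hG _ y
  set p := G.heat hG t f
  rw [laplacianCLM_apply, hfun, Gam2, Gam]
  change 1 / 2 * G.laplacian (fun z => G.laplacian p z * p z + p z * G.laplacian p z) x
    - (G.laplacian p x * G.laplacian p x + p x * G.laplacian (G.laplacian p) x) = _
  have h2 : G.laplacian (fun z => G.laplacian p z * p z + p z * G.laplacian p z) x
      = 2 * G.laplacian (fun z => p z * G.laplacian p z) x := by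
    rw [G.laplacian_eq_sum (fun z => G.laplacian p z * p z + p z * G.laplacian p z),
      G.laplacian_eq_sum (fun z => p z * G.laplacian p z), Finset.mul_sum]
    exact Finset.sum_congr rfl fun y _ => by ring
  rw [h2]
  ring

end MWGraph

/-! ### Gradient decay under Kato-small negative curvature. -/

namespace MWGraph

variable {V : Type*}

theorem continuous_gammaLp_heat (G : MWGraph V) (hG : G.BoundedDegree)
    (f : lp (fun _ : V => ℝ) ∞) : Continuous fun s => G.gammaLp hG (G.heat hG s f) :=
  continuous_iff_continuousAt.2 fun t =>
    (G.exists_hasDerivAt_gammaLp_heat hG f t).choose_spec.1.continuousAt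

theorem continuous_norm_heat_apply (G : MWGraph V) (hG : G.BoundedDegree)
    (f : lp (fun _ : V => ℝ) ∞) : Continuous fun s => ‖G.heat hG s f‖ :=
  ((G.continuous_heat hG).clm_apply continuous_const).norm

/-- Duhamel's principle for `Γ(P_t f)` under the curvature bound `Γ₂ ≥ (K - v) Γ`. -/
theorem exp_mul_gammaLp_heat_le (G : MWGraph V) (hG : G.BoundedDegree) {K : ℝ}
    {v : lp (fun _ : V => ℝ) ∞} (hv : ∀ x, 0 ≤ v x)
    (hcurv : ∀ (f : lp (fun _ : V => ℝ) ∞) (x : V), (K - v x) * G.Gam f f x ≤ G.Gam2 f f x)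
    (f : lp (fun _ : V => ℝ) ∞) {t M : ℝ} (ht : 0 ≤ t)
    (hM : ∀ s ∈ Set.Icc 0 t, Real.exp (2 * K * s) * ‖G.gammaLp hG (G.heat hG s f)‖ ≤ M) (x : V) :
    Real.exp (2 * K * t) * G.gammaLp hG (G.heat hG t f) x ≤
      ‖G.gammaLp hG f‖ + 2 * M * ∫ s in (0 : ℝ)..t, ‖G.heat hG s v‖ := by
  set u : ℝ → lp (fun _ : V => ℝ) ∞ := fun s => G.gammaLp hG (G.heat hG s f)
  choose u' hu' hu'x using G.exists_hasDerivAt_gammaLp_heat hG f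
  -- The interpolation runs from `P_t Γ(f)(x)` at `s = 0` to `e^{2Kt} Γ(P_t f)(x)` at `s = t`.
  set φ : ℝ → ℝ := fun s => Real.exp (2 * K * s) * G.heat hG (t - s) (u s) x
  have hφ : ∀ s, HasDerivAt φ (Real.exp (2 * K * s) *
      G.heat hG (t - s) ((2 * K) • u s - G.laplacianCLM hG (u s) + u' s) x) s := by
    intro s
    have h1 : HasDerivAt (fun s => Real.exp (2 * K * s)) (Real.exp (2 * K * s) * (2 * K)) s := by
      simpa using ((hasDerivAt_id s).const_mul (2 * K)).exp
    have h2 := ((G.hasDerivAt_heat hG (t - s)).comp_const_sub t s).clm_apply (hu' s)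
    have h3 := (lp.evalCLM ℝ (fun _ : V => ℝ) ∞ x).hasFDerivAt.comp_hasDerivAt s h2
    refine (h1.mul h3).congr_deriv ?_
    rw [(G.heat hG (t - s)).map_add, (G.heat hG (t - s)).map_sub, (G.heat hG (t - s)).map_smul]
    change Real.exp (2 * K * s) * (2 * K) * G.heat hG (t - s) (u s) x
      + Real.exp (2 * K * s) * (-(G.heat hG (t - s) (G.laplacianCLM hG (u s)) x)
        + G.heat hG (t - s) (u' s) x)
      = Real.exp (2 * K * s) * (2 * K * G.heat hG (t - s) (u s) x
        - G.heat hG (t - s) (G.laplacianCLM hG (u s)) x + G.heat hG (t - s) (u' s) x)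
    ring
  have hbound : ∀ s ∈ Set.Ioo 0 t, Real.exp (2 * K * s) *
      G.heat hG (t - s) ((2 * K) • u s - G.laplacianCLM hG (u s) + u' s) x
      ≤ 2 * M * ‖G.heat hG (t - s) v‖ := by
    intro s hs
    -- The terms `ΔΓ` cancel, leaving `2KΓ - 2Γ₂ ≤ 2vΓ ≤ 2‖Γ‖v`; monotonicity of `P_{t-s}` then
    -- applies.
    have hz : ∀ y, ((2 * K) • u s - G.laplacianCLM hG (u s) + u' s : lp (fun _ : V => ℝ) ∞) y
        ≤ ((2 * ‖u s‖) • v : lp (fun _ : V => ℝ) ∞) y := by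
      intro y
      change 2 * K * u s y - G.laplacianCLM hG (u s) y + u' s y ≤ 2 * ‖u s‖ * v y
      have hc := hcurv (G.heat hG s f) y
      rw [← G.gammaLp_apply hG] at hc
      change (K - v y) * u s y ≤ _ at hc
      have h1 : v y * u s y ≤ v y * ‖u s‖ :=
        mul_le_mul_of_nonneg_left ((le_abs_self _).trans (abs_apply_le_norm _ y)) (hv y)
      rw [hu'x s y]
      change 2 * K * u s y - G.laplacianCLM hG (u s) y
        + (G.laplacianCLM hG (u s) y - _) ≤ _
      linarith
    have hH := G.heat_mono hG (sub_nonneg.2 hs.2.le) hz x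
    rw [map_smul] at hH
    change _ ≤ 2 * ‖u s‖ * G.heat hG (t - s) v x at hH
    have hle : G.heat hG (t - s) v x ≤ ‖G.heat hG (t - s) v‖ :=
      (le_abs_self _).trans (abs_apply_le_norm _ x)
    calc _ ≤ Real.exp (2 * K * s) * (2 * ‖u s‖ * ‖G.heat hG (t - s) v‖) :=
          mul_le_mul_of_nonneg_left (hH.trans (mul_le_mul_of_nonneg_left hle (by positivity)))
            (Real.exp_pos _).le
      _ = 2 * (Real.exp (2 * K * s) * ‖u s‖) * ‖G.heat hG (t - s) v‖ := by ring
      _ ≤ _ := by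
          have := hM s ⟨hs.1.le, hs.2.le⟩
          gcongr
  have hcont : Continuous fun s => 2 * M * ‖G.heat hG (t - s) v‖ :=
    continuous_const.mul ((G.continuous_norm_heat_apply hG v).comp (continuous_const.sub
      continuous_id))
  have hint := intervalIntegral.sub_le_integral_of_hasDeriv_right_of_le ht
    (fun s _ => (hφ s).continuousAt.continuousWithinAt) (fun s _ => (hφ s).hasDerivWithinAt)
    (hcont.integrableOn_Icc) hbound
  rw [intervalIntegral.integral_const_mul,
    intervalIntegral.integral_comp_sub_left (fun s => ‖G.heat hG s v‖) t] at hint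
  have h0 : φ 0 ≤ ‖G.gammaLp hG f‖ := by
    have := G.heat_apply_le_norm hG ht (G.gammaLp hG f) x
    simpa [φ, u, heat_zero] using this
  have h1 : φ t = Real.exp (2 * K * t) * G.gammaLp hG (G.heat hG t f) x := by
    simp [φ, u, heat_zero]
  rw [sub_self, sub_zero] at hint
  linarith

theorem norm_gammaLp_le (G : MWGraph V) (hG : G.BoundedDegree) (f : lp (fun _ : V => ℝ) ∞)
    {C : ℝ} (hC0 : 0 ≤ C) (hC : ∀ x, G.gammaLp hG f x ≤ C) : ‖G.gammaLp hG f‖ ≤ C :=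
  lp.norm_le_of_forall_le hC0 fun x => by
    rw [Real.norm_of_nonneg (G.gammaLp_nonneg hG f x)]
    exact hC x

/-- Decay of `Γ(P_t f)` on `[0, T]` when the negative part of the curvature is Kato-small. -/
theorem norm_gammaLp_heat_le_of_mem_Icc (G : MWGraph V) (hG : G.BoundedDegree) {K T β : ℝ}
    (hT : 0 ≤ T) (hβ : 2 * β < 1)
    {v : lp (fun _ : V => ℝ) ∞} (hv : ∀ x, 0 ≤ v x)
    (hcurv : ∀ (f : lp (fun _ : V => ℝ) ∞) (x : V), (K - v x) * G.Gam f f x ≤ G.Gam2 f f x)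
    (hint : ∀ t ∈ Set.Icc 0 T, ∫ s in (0 : ℝ)..t, ‖G.heat hG s v‖ ≤ β)
    (f : lp (fun _ : V => ℝ) ∞) {t : ℝ} (ht : t ∈ Set.Icc 0 T) :
    Real.exp (2 * K * t) * ‖G.gammaLp hG (G.heat hG t f)‖ ≤ ‖G.gammaLp hG f‖ / (1 - 2 * β) := by
  obtain ⟨r, hr, hmax⟩ := isCompact_Icc.exists_isMaxOn (Set.nonempty_Icc.2 hT)
    (f := fun s => Real.exp (2 * K * s) * ‖G.gammaLp hG (G.heat hG s f)‖)
    ((Real.continuous_exp.comp (continuous_const.mul continuous_id)).mul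
      (G.continuous_gammaLp_heat hG f).norm).continuousOn
  set M := Real.exp (2 * K * r) * ‖G.gammaLp hG (G.heat hG r f)‖ with hMdef
  have hM0 : 0 ≤ M := by positivity
  have hβ0 : 0 ≤ β := by simpa using hint 0 ⟨le_rfl, hT⟩
  -- Duhamel at the maximiser `r` bounds the finite maximum `M` by itself; `2β < 1` lets `2Mβ` be
  -- absorbed.
  have hbd : M ≤ ‖G.gammaLp hG f‖ + 2 * M * β := by
    have hC : ∀ x, G.gammaLp hG (G.heat hG r f) x
        ≤ Real.exp (-(2 * K * r)) * (‖G.gammaLp hG f‖ + 2 * M * β) := by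
      intro x
      have h := G.exp_mul_gammaLp_heat_le hG hv hcurv f hr.1
        (fun s hs => hmax ⟨hs.1, hs.2.trans hr.2⟩) x
      rw [Real.exp_neg, inv_mul_eq_div, le_div_iff₀' (Real.exp_pos _)]
      refine h.trans ?_
      gcongr
      exact hint r hr
    have h := G.norm_gammaLp_le hG _ (by positivity) hC
    rwa [Real.exp_neg, inv_mul_eq_div, le_div_iff₀' (Real.exp_pos _)] at h
  refine (hmax ht).trans ?_
  change M ≤ _
  rw [le_div_iff₀ (by linarith)]
  linarith

/-- Exponential decay of `Γ(P_t f)`. -/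
theorem norm_gammaLp_heat_le (G : MWGraph V) (hG : G.BoundedDegree) {K T : ℝ}
    (hT : 0 < T) (hK : 0 < K) {v : lp (fun _ : V => ℝ) ∞} (hv : ∀ x, 0 ≤ v x)
    (hcurv : ∀ (f : lp (fun _ : V => ℝ) ∞) (x : V), (K - v x) * G.Gam f f x ≤ G.Gam2 f f x)
    (hint : ∀ t ∈ Set.Icc 0 T,
      ∫ s in (0 : ℝ)..t, ‖G.heat hG s v‖ ≤ 1 / 4 * (1 - Real.exp (-(K * T / 2))))
    (f : lp (fun _ : V => ℝ) ∞) {t : ℝ} (ht : 0 ≤ t) :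
    ‖G.gammaLp hG (G.heat hG t f)‖ ≤
      Real.exp (K * T) * Real.exp (-(K * t)) * ‖G.gammaLp hG f‖ := by
  have hz0 := Real.exp_pos (-(K * T / 2))
  have hz1 : Real.exp (-(K * T / 2)) ≤ 1 := Real.exp_le_one_iff.2 (by
    have := mul_pos hK hT
    linarith)
  have hsq : Real.exp (-(K * T)) = Real.exp (-(K * T / 2)) * Real.exp (-(K * T / 2)) := by
    rw [← Real.exp_add]
    congr 1
    ring
  have hstep : ∀ (f : lp (fun _ : V => ℝ) ∞), ∀ t ∈ Set.Icc 0 T,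
      ‖G.gammaLp hG (G.heat hG t f)‖ ≤
        Real.exp (K * T - 2 * K * t) * ‖G.gammaLp hG f‖ := by
    intro f t ht
    have h := G.norm_gammaLp_heat_le_of_mem_Icc hG hT.le (by linarith) hv hcurv hint f ht
    have h2 : ‖G.gammaLp hG f‖ / (1 - 2 * (1 / 4 * (1 - Real.exp (-(K * T / 2)))))
        ≤ Real.exp (K * T) * ‖G.gammaLp hG f‖ := by
      rw [div_le_iff₀ (by linarith)]
      -- With `z = e^{-KT/2} ≤ 1` the bracket is `(1 + z)/2 ≥ z² = e^{-KT}`.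
      have h3 : 1 ≤ Real.exp (K * T) * (1 - 2 * (1 / 4 * (1 - Real.exp (-(K * T / 2))))) := by
        rw [← inv_le_iff_one_le_mul₀' (Real.exp_pos _), ← Real.exp_neg, hsq]
        nlinarith
      nlinarith [norm_nonneg (G.gammaLp hG f)]
    rw [Real.exp_sub, div_mul_eq_mul_div, le_div_iff₀' (Real.exp_pos _)]
    exact h.trans h2
  -- Each full period `T` contributes `e^{KT - 2KT} = e^{-KT}`: half of the rate `2K` pays for the
  -- constant. The prefactor `e^{KT}` is lost only once, on the remainder `r`.
  have hiter : ∀ (k : ℕ), ∀ r ∈ Set.Icc 0 T, ‖G.gammaLp hG (G.heat hG (k * T + r) f)‖ ≤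
      Real.exp (K * T) * Real.exp (-(K * (k * T + r))) * ‖G.gammaLp hG f‖ := by
    intro k
    induction k with
    | zero =>
      intro r hr
      refine (hstep f r ⟨hr.1, hr.2⟩ |> le_of_eq_of_le (by simp)).trans ?_
      rw [← Real.exp_add]
      gcongr
      have := mul_nonneg hK.le hr.1
      push_cast
      linarith
    | succ k ih =>
      intro r hr
      have heq : ((k + 1 : ℕ) : ℝ) * T + r = T + (k * T + r) := by push_cast; ring
      rw [heq, G.heat_add]
      refine (hstep _ T ⟨hT.le, le_rfl⟩).trans ?_
      have h := mul_le_mul_of_nonneg_left (ih r hr) (Real.exp_pos (K * T - 2 * K * T)).le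
      refine h.trans (le_of_eq ?_)
      rw [← mul_assoc, ← Real.exp_add, ← Real.exp_add, ← Real.exp_add]
      congr 2
      ring
  have hfl := Nat.floor_le (div_nonneg ht hT.le)
  have hlt := Nat.lt_floor_add_one (t / T)
  rw [le_div_iff₀ hT] at hfl
  rw [div_lt_iff₀ hT] at hlt
  have h := hiter ⌊t / T⌋₊ (t - ⌊t / T⌋₊ * T) ⟨by linarith, by linarith⟩
  rwa [add_sub_cancel] at h

end MWGraph

/-! ### From gradient decay to distances. -/

namespace MWGraph

variable {V : Type*}

/-- Every truncation is one term of the supremum defining `katoConst`, so the Kato bound holds for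
the bounded potential to which Duhamel applies. -/
theorem integral_norm_heat_trunc_le (G : MWGraph V) (hG : G.BoundedDegree) {T β : ℝ} (hβ : 0 ≤ β)
    {W : V → ℝ≥0} (h : G.katoConst hG T W ≤ ENNReal.ofReal β) (j : ℕ) {t : ℝ}
    (ht : t ∈ Set.Icc 0 T) : ∫ s in (0 : ℝ)..t, ‖G.heat hG s (trunc j W)‖ ≤ β := by
  have hle : ∫⁻ s in Set.Ioc 0 t, ‖G.heat hG s (trunc j W)‖ₑ ≤ ENNReal.ofReal β :=
    (MeasureTheory.lintegral_mono_set (Set.Ioc_subset_Ioc_right ht.2)).trans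
      ((le_iSup (fun j : ℕ => ∫⁻ s in Set.Ioc 0 T, ‖G.heat hG s (trunc j W)‖ₑ) j).trans h)
  simp only [← ofReal_norm] at hle
  have hc := G.continuous_norm_heat_apply hG (trunc j W)
  rw [← MeasureTheory.ofReal_integral_eq_lintegral_ofReal (hc.integrableOn_Ioc)
    (Filter.Eventually.of_forall fun s => norm_nonneg _), ENNReal.ofReal_le_ofReal_iff hβ] at hle
  rwa [intervalIntegral.integral_of_le ht.1]

theorem reachable (G : MWGraph V) (x y : V) : G.toSimpleGraph.Reachable x y :=
  (SimpleGraph.reachable_iff_reflTransGen x y).2 (G.connected x y)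

/-- If `Γ(g_t)` tends to zero pointwise, then so do all differences `g_t(y) - g_t(x)`. -/
theorem tendsto_sub_of_tendsto_Gam (G : MWGraph V) {ι : Type*} {l : Filter ι} (g : ι → V → ℝ)
    (h : ∀ x, Filter.Tendsto (fun t => G.Gam (g t) (g t) x) l (nhds 0)) (x y : V) :
    Filter.Tendsto (fun t => g t y - g t x) l (nhds 0) := by
  induction G.connected x y with
  | refl => simpa using tendsto_const_nhds
  | @tail b c _ hbc ih =>
    have hq : 0 < G.q b c := div_pos hbc (G.m_pos b)
    have hsq : Filter.Tendsto (fun t => (g t c - g t b) ^ 2) l (nhds 0) := by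
      have h2 : Filter.Tendsto (fun t => 2 * G.Gam (g t) (g t) b / G.q b c) l (nhds 0) := by
        simpa using ((h b).const_mul 2).div_const (G.q b c)
      refine squeeze_zero (fun t => sq_nonneg _) (fun t => ?_) h2
      rw [le_div_iff₀' hq]
      exact G.q_mul_sub_sq_le (g t) hbc
    have habs : Filter.Tendsto (fun t => g t c - g t b) l (nhds 0) := by
      rw [tendsto_zero_iff_abs_tendsto_zero]
      have := (Real.continuous_sqrt.tendsto 0).comp hsq
      simpa [Function.comp_def, Real.sqrt_sq_eq_abs] using this
    simpa using habs.add ih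

/-- If `Γ(P_t f) ≤ A² e^{-Kt} Deg_max / 2`, then the heat flow moves `f` by at most
`2 Deg_max A / K`. -/
theorem abs_heat_sub_le (G : MWGraph V) (hG : G.BoundedDegree) {K A : ℝ} (hK : 0 < K)
    (hA : 0 ≤ A) (f : lp (fun _ : V => ℝ) ∞)
    (h : ∀ t, 0 ≤ t → ∀ x, G.Gam (G.heat hG t f) (G.heat hG t f) x ≤
      A ^ 2 * Real.exp (-(K * t)) * (G.degMax / 2)) {t : ℝ} (ht : 0 ≤ t) (x : V) :
    |G.heat hG t f x - f x| ≤ 2 * G.degMax * A / K := by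
  have hD := G.degMax_nonneg
  have hder : ∀ s, HasDerivAt (fun s => G.heat hG s f x - f x)
      (G.laplacian (G.heat hG s f) x) s := by
    intro s
    have h2 := (G.hasDerivAt_heat' hG s).clm_apply (hasDerivAt_const s f)
    have h3 := (lp.evalCLM ℝ (fun _ : V => ℝ) ∞ x).hasFDerivAt.comp_hasDerivAt s h2
    refine (h3.sub_const (f x)).congr_deriv ?_
    rw [(G.heat hG s).map_zero, add_zero]
    rfl
  -- An antiderivative, vanishing at `0`, of the bound on `|Δ P_s f|`; the square root has halved
  -- the rate `K`.
  have hB : ∀ s, HasDerivAt (fun s => 2 * G.degMax * A / K * (1 - Real.exp (-(K / 2) * s)))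
      (G.degMax * A * Real.exp (-(K / 2) * s)) s := by
    intro s
    have h1 : HasDerivAt (fun s => Real.exp (-(K / 2) * s))
        (Real.exp (-(K / 2) * s) * (-(K / 2))) s := by
      simpa using ((hasDerivAt_id s).const_mul (-(K / 2))).exp
    refine ((h1.const_sub 1).const_mul (2 * G.degMax * A / K)).congr_deriv ?_
    field_simp
  have hbound : ∀ s ∈ Set.Ico 0 t, ‖G.laplacian (G.heat hG s f) x‖ ≤
      G.degMax * A * Real.exp (-(K / 2) * s) := by
    intro s hs
    refine abs_le_of_sq_le_sq ?_ (by positivity)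
    have h1 := G.laplacian_sq_le hG (G.heat hG s f) x
    have h2 := mul_le_mul_of_nonneg_left (h s hs.1 x) (by positivity : 0 ≤ 2 * G.degMax)
    refine h1.trans (h2.trans (le_of_eq ?_))
    have h3 : Real.exp (-(K * s)) = Real.exp (-(K / 2) * s) ^ 2 := by
      rw [← Real.exp_nat_mul]
      congr 1
      push_cast
      ring
    rw [h3]
    ring
  have hmv := image_norm_le_of_norm_deriv_right_le_deriv_boundary
    (f := fun s => G.heat hG s f x - f x) (a := 0) (b := t)
    (fun s _ => (hder s).continuousAt.continuousWithinAt)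
    (fun s _ => (hder s).hasDerivWithinAt) (by simp [heat_zero]) hB hbound
    (Set.right_mem_Icc.2 ht)
  refine hmv.trans (mul_le_of_le_one_right (by positivity) ?_)
  linarith [Real.exp_pos (-(K / 2) * t)]

/-- The distance function to `x₀`, truncated at `N`. -/
noncomputable def truncDist (G : MWGraph V) (x₀ : V) (N : ℕ) : lp (fun _ : V => ℝ) ∞ :=
  toLinfty (fun z => (min (G.toSimpleGraph.dist x₀ z) N : ℕ)) N fun z => by
    rw [abs_of_nonneg (Nat.cast_nonneg _)]
    exact_mod_cast min_le_right _ _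

theorem truncDist_apply (G : MWGraph V) (x₀ : V) (N : ℕ) (z : V) :
    G.truncDist x₀ N z = (min (G.toSimpleGraph.dist x₀ z) N : ℕ) := rfl

theorem abs_truncDist_sub_le (G : MWGraph V) (x₀ : V) (N : ℕ) (x y : V) (h : 0 < G.w x y) :
    |G.truncDist x₀ N y - G.truncDist x₀ N x| ≤ 1 := by
  have hadj : G.toSimpleGraph.Adj x y := h
  have hd := hadj.diff_dist_adj (u := x₀)
  rw [truncDist_apply, truncDist_apply, abs_le]
  have h1 : min (G.toSimpleGraph.dist x₀ y) N ≤ min (G.toSimpleGraph.dist x₀ x) N + 1 := by omega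
  have h2 : min (G.toSimpleGraph.dist x₀ x) N ≤ min (G.toSimpleGraph.dist x₀ y) N + 1 := by omega
  have h1' : ((min (G.toSimpleGraph.dist x₀ y) N : ℕ) : ℝ)
      ≤ (min (G.toSimpleGraph.dist x₀ x) N : ℕ) + 1 := by exact_mod_cast h1
  have h2' : ((min (G.toSimpleGraph.dist x₀ x) N : ℕ) : ℝ)
      ≤ (min (G.toSimpleGraph.dist x₀ y) N : ℕ) + 1 := by exact_mod_cast h2
  constructor <;> linarith

/-- Exponential decay of the gradient along the heat flow bounds the combinatorial distance. -/
theorem dist_le_of_gammaLp_decay (G : MWGraph V) (hG : G.BoundedDegree) {K A : ℝ} (hK : 0 < K)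
    (hA : 0 ≤ A)
    (h : ∀ (f : lp (fun _ : V => ℝ) ∞) (t : ℝ), 0 ≤ t → ‖G.gammaLp hG (G.heat hG t f)‖ ≤
      A ^ 2 * Real.exp (-(K * t)) * ‖G.gammaLp hG f‖) (x y : V) :
    (G.toSimpleGraph.dist x y : ℝ) ≤ 4 * G.degMax * A / K := by
  set N := G.toSimpleGraph.dist x y with hN
  -- Truncation at `N = d(x,y)` makes the distance bounded without changing its value at `y`.
  set f := G.truncDist x N
  have hD := G.degMax_nonneg
  have hf : ‖G.gammaLp hG f‖ ≤ G.degMax / 2 :=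
    G.norm_gammaLp_le hG f (by positivity) fun z => by
      rw [gammaLp_apply]
      exact G.Gam_self_le_of_lipschitz hG f (G.abs_truncDist_sub_le x N) z
  have hdecay : ∀ t, 0 ≤ t → ∀ z, G.Gam (G.heat hG t f) (G.heat hG t f) z ≤
      A ^ 2 * Real.exp (-(K * t)) * (G.degMax / 2) := by
    intro t ht z
    rw [← G.gammaLp_apply hG]
    refine ((le_abs_self _).trans (abs_apply_le_norm _ z)).trans ((h f t ht).trans ?_)
    gcongr
  have htends : ∀ z, Filter.Tendsto (fun t => G.Gam (G.heat hG t f) (G.heat hG t f) z)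
      Filter.atTop (nhds 0) := by
    intro z
    have hexp : Filter.Tendsto (fun t => Real.exp (-(K * t))) Filter.atTop (nhds 0) :=
      Real.tendsto_exp_neg_atTop_nhds_zero.comp (Filter.tendsto_id.const_mul_atTop hK)
    refine squeeze_zero' (Filter.Eventually.of_forall fun t => G.Gam_self_nonneg _ z)
      ((Filter.eventually_ge_atTop 0).mono fun t ht => hdecay t ht z) ?_
    simpa using (hexp.const_mul (A ^ 2)).mul_const (G.degMax / 2)
  have hlim := (G.tendsto_sub_of_tendsto_Gam (fun t => G.heat hG t f) htends x y).add_const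
    (4 * G.degMax * A / K)
  rw [zero_add] at hlim
  refine ge_of_tendsto hlim ((Filter.eventually_ge_atTop 0).mono fun t ht => ?_)
  have hx := abs_le.1 (G.abs_heat_sub_le hG hK hA f hdecay ht x)
  have hy := abs_le.1 (G.abs_heat_sub_le hG hK hA f hdecay ht y)
  have hfx : f x = 0 := by simp [f, truncDist_apply]
  have hfy : f y = N := by simp [f, truncDist_apply, hN]
  have hsplit : 4 * G.degMax * A / K = 2 * G.degMax * A / K + 2 * G.degMax * A / K := by ring
  rw [hfx] at hx
  rw [hfy] at hy
  rw [hsplit]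
  linarith [hx.2, hy.1]

end MWGraph

/-! ### The diameter bound. -/

theorem mainTheorem3 {V : Type*} [Countable V] (G : MWGraph V) (hG : G.BoundedDegree)
    (T K : ℝ) (hT : 0 < T) (hK : 0 < K) (n : ℝ≥0∞) (hn : 0 < n) (ρ : V → ℝ)
    (hCD : G.CD ρ n)
    (hKato : G.katoConst hG T (fun x => ⟨(ρ x - K)⁻, negPart_nonneg _⟩) ≤
      ENNReal.ofReal (1 / 4 * (1 - Real.exp (-(K * T / 2))))) :
    G.toSimpleGraph.ediam ≠ ⊤ ∧
      (G.toSimpleGraph.diam : ℝ) ≤ 4 * G.degMax * Real.exp (K * T / 2) / K := by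
  obtain ⟨j, hj⟩ := exists_nat_ge (G.degMax + K)
  set W : V → ℝ≥0 := fun x => ⟨(ρ x - K)⁻, negPart_nonneg _⟩
  have hβ : 0 ≤ 1 / 4 * (1 - Real.exp (-(K * T / 2))) := by
    have : Real.exp (-(K * T / 2)) ≤ 1 := Real.exp_le_one_iff.2 (by
      have := mul_pos hK hT
      linarith)
    linarith
  have hsq : Real.exp (K * T) = Real.exp (K * T / 2) ^ 2 := by
    rw [← Real.exp_nat_mul]
    congr 1
    push_cast
    ring
  have hdist : ∀ x y, (G.toSimpleGraph.dist x y : ℝ) ≤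
      4 * G.degMax * Real.exp (K * T / 2) / K := by
    -- Here `A = e^{KT/2}`, so that `A² = e^{KT}` is the constant of the gradient decay.
    refine G.dist_le_of_gammaLp_decay hG hK (Real.exp_pos _).le fun f t ht => ?_
    rw [← hsq]
    exact G.norm_gammaLp_heat_le hG hT hK (v := MWGraph.trunc j W)
      (fun x => le_min j.cast_nonneg (W x).coe_nonneg)
      (fun f x => hCD.truncated hG hj f ⟨‖f‖, MWGraph.abs_apply_le_norm f⟩ x)
      (fun t ht => G.integral_norm_heat_trunc_le hG hβ hKato j ht) f ht
  -- A bound on `ediam` by a natural number is needed because `diam` takes the default value `0`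
  -- when `ediam = ⊤`.
  have hediam : G.toSimpleGraph.ediam ≤
      (⌊4 * G.degMax * Real.exp (K * T / 2) / K⌋₊ : ℕ) := by
    refine SimpleGraph.ediam_le_of_edist_le fun x y => ?_
    rw [← (G.reachable x y).coe_dist_eq_edist]
    exact_mod_cast Nat.le_floor (hdist x y)
  have hD := G.degMax_nonneg
  refine ⟨ne_top_of_le_ne_top (ENat.natCast_ne_top _) hediam, ?_⟩
  have h1 : G.toSimpleGraph.diam ≤ ⌊4 * G.degMax * Real.exp (K * T / 2) / K⌋₊ :=
    ENat.toNat_le_of_le_natCast hediam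
  exact (Nat.cast_le.2 h1).trans (Nat.floor_le (by positivity))
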